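/- Let $p$ be a prime, $K$ a field of characteristic $p$, and $n\ge 0$ an integer. For a commutative $K$-algebra $R$, let $R[F;\sigma]$ be the skew polynomial ring over $R$ with $F\lambda=\lambda^pF$, and let $$U_n(R)=\Big\{1+\sum_{i=1}^n\lambda_iF^i \;\Big|\; \lambda_i^{p^{\,n-i+1}}=0 \text{ for } 1\le i\le n\Big\},$$ a subgroup of the unit group $R[F;\sigma]^\times$. The group-valued functor $R\mapsto U_n(R)$ is an affine group scheme $U_n$ over $K$. For $m\ge 0$ let $\alpha_{p^m}$ be the group scheme with $\alpha_{p^m}(R)=\{a\in R\mid a^{p^m}=0\}$ under addition. The upper central series $Z_0\subset Z_1\subset\cdots$ of $U_n$ is given by $Z_0=\{1\}$ and by letting $x\in U_n(R)$ belong to $Z_{s+1}(R)$ if and only if, for every flat ring extension $R\subset R'$ and every $g\in U_n(R')$, one has $xgx^{-1}g^{-1}\in Z_s(R')$. The lower central series $\Gamma^0\supset\Gamma^1\supset\cdots$ of $U_n$ is given by $\Gamma^0=U_n$ and by letting $\Gamma^{r+1}=[U_n,\Gamma^r]$ be the smallest closed subgroup scheme of $U_n$ through which the commutator map $U_n\times\Gamma^r\to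 U_n$, $(g,x)\mapsto gxg^{-1}x^{-1}$, factors. For $0\le r\le n$ put $$G_r(R)=\Big\{1+\sum_{i=n-r+1}^n\lambda_iF^i\in U_n(R)\Big\}.$$ Then the $G_r$ are closed subgroup schemes of $U_n$, with $\{1\}=G_0\subset G_1\subset\cdots\subset G_n=U_n$. This chain is both the upper and the lower central series of $U_n$: for $0\le r\le n$ we have $Z_r=G_r$ and $\Gamma^{n-r}=G_r$. Moreover, for $0\le r<n$ the quotient group scheme (that is, the fppf quotient) $G_{r+1}/G_r$ is isomorphic to $\alpha_{p^{r+1}}$. -/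

import Mathlib

open CategoryTheory

universe u v

namespace FrobeniusSkew

noncomputable section

/-! ### The skew polynomial ring `R[F; σ]` of an algebra in characteristic `p` -/

section SkewRing

theorem add_pow_pow (p : ℕ) [Fact p.Prime] (K : Type u) [Field K] [CharP K p]
    (R : Type v) [CommRing R] [Algebra K R] (a b : R) (k : ℕ) :
    (a + b) ^ p ^ k = a ^ p ^ k + b ^ p ^ k := by
  rcases subsingleton_or_nontrivial R with h | h
  · exact Subsingleton.elim _ _
  · have : CharP R p := charP_of_injective_algebraMap (algebraMap K R).injective p
    exact add_pow_char_pow a b p k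

theorem zero_pow_pow (p : ℕ) [Fact p.Prime] (R : Type v) [CommRing R] (k : ℕ) :
    (0 : R) ^ p ^ k = 0 :=
  zero_pow (pow_ne_zero _ (Nat.Prime.ne_zero Fact.out))

/-- The action of `ℕ` on a `K`-algebra `R` (with `K` a field of characteristic `p`) by iterates of
the Frobenius map `σ : a ↦ a ^ p`; the natural number `k` acts by `a ↦ a ^ p ^ k`. -/
@[reducible]
def frobeniusAction (p : ℕ) [Fact p.Prime] (K : Type u) [Field K] [CharP K p]
    (R : Type v) [CommRing R] [Algebra K R] : MulSemiringAction (Multiplicative ℕ) R where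
  smul k a := a ^ p ^ k.toAdd
  one_smul a := by change a ^ p ^ 0 = a; simp
  mul_smul k l a := by
    change a ^ p ^ (k.toAdd + l.toAdd) = (a ^ p ^ l.toAdd) ^ p ^ k.toAdd
    rw [← pow_mul, ← pow_add, add_comm]
  smul_zero k := zero_pow_pow p R _
  smul_add k a b := add_pow_pow p K R a b _
  smul_one k := one_pow _
  smul_mul k a b := mul_pow a b _

/-- The skew polynomial ring `R[F; σ]`, where `σ` is the Frobenius map, so that
`F * a = a ^ p * F`. -/
def SkewPol (_p : ℕ) (_K : Type u) (R : Type v) [CommRing R] : Type v :=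
  SkewPolynomial R

instance (p : ℕ) [Fact p.Prime] (K : Type u) [Field K] [CharP K p]
    (R : Type v) [CommRing R] [Algebra K R] : Ring (SkewPol p K R) :=
  letI := frobeniusAction p K R
  inferInstanceAs (Ring (SkewPolynomial R))

variable {p : ℕ} {K : Type u}

/-- The coefficient of `F ^ i` in `∑ i, λ_i F ^ i`. -/
def SkewPol.coeff {R : Type v} [CommRing R] (P : SkewPol p K R) (i : ℕ) : R :=
  SkewPolynomial.coeff P i

theorem SkewPol.ext {R : Type v} [CommRing R] {P Q : SkewPol p K R}
    (h : ∀ i, P.coeff i = Q.coeff i) : P = Q :=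
  SkewMonoidAlgebra.ext fun a => h a.toAdd

variable [Fact p.Prime] [Field K] [CharP K p]

theorem SkewPol.coeff_one {R : Type v} [CommRing R] [Algebra K R] (i : ℕ) :
    (1 : SkewPol p K R).coeff i = if i = 0 then 1 else 0 := by
  let _ := frobeniusAction p K R
  have h := SkewPolynomial.coeff_one (R := R) i
  simp only [eq_comm (a := 0)] at h
  exact h

theorem SkewPol.coeff_mul {R : Type v} [CommRing R] [Algebra K R] (P Q : SkewPol p K R) (k : ℕ) :
    (P * Q).coeff k = ∑ ij ∈ Finset.HasAntidiagonal.antidiagonal k, P.coeff ij.1 * Q.coeff ij.2 ^ p ^ ij.1 := by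
  let _ := frobeniusAction p K R
  have h := SkewMonoidAlgebra.coeff_mul_antidiagonal_of_finset (k := R) (G := Multiplicative ℕ)
    P Q (Multiplicative.ofAdd k) (Finset.HasAntidiagonal.antidiagonal (A := ℕ) k)
    (fun {q} => Finset.HasAntidiagonal.mem_antidiagonal (A := ℕ))
  exact h

/-- The coefficientwise map `R[F; σ] → S[F; σ]` induced by a homomorphism `R → S`. -/
def SkewPol.map {R S : Type v} [CommRing R] [Algebra K R] [CommRing S] [Algebra K S]
    (f : R →ₐ[K] S) : SkewPol p K R →* SkewPol p K S where
  toFun P := SkewMonoidAlgebra.ofCoeff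
    (Finsupp.mapRange f (map_zero f) (SkewMonoidAlgebra.coeff (k := R) (G := Multiplicative ℕ) P))
  map_one' := by
    refine SkewPol.ext (p := p) (K := K) fun i => ?_
    rw [SkewPol.coeff_one]
    change f ((1 : SkewPol p K R).coeff i) = _
    rw [SkewPol.coeff_one]
    split <;> simp
  map_mul' P Q := by
    refine SkewPol.ext (p := p) (K := K) fun i => ?_
    refine Eq.trans ?_ (SkewPol.coeff_mul _ _ i).symm
    change f ((P * Q).coeff i) = ∑ ij ∈ Finset.HasAntidiagonal.antidiagonal i,
      f (P.coeff ij.1) * f (Q.coeff ij.2) ^ p ^ ij.1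
    rw [SkewPol.coeff_mul, map_sum]
    simp

theorem SkewPol.coeff_map {R S : Type v} [CommRing R] [Algebra K R] [CommRing S] [Algebra K S]
    (f : R →ₐ[K] S) (P : SkewPol p K R) (i : ℕ) : (SkewPol.map f P).coeff i = f (P.coeff i) :=
  rfl

end SkewRing

/-! ### The groups `U_n(R)` and `α_{p^m}(R)` -/

section Groups

/-- The skew polynomials `1 + ∑_{i = 1}^n λ_i F ^ i` with `λ_i ^ p ^ (n - i + 1) = 0` for
`1 ≤ i ≤ n`. -/
def IsUPoint (p : ℕ) (K : Type u) (n : ℕ) {R : Type v} [CommRing R] (P : SkewPol p K R) : Prop :=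
  P.coeff 0 = 1 ∧ (∀ i, 1 ≤ i → i ≤ n → P.coeff i ^ p ^ (n - i + 1) = 0) ∧
    ∀ i, n < i → P.coeff i = 0

variable {p : ℕ} {K : Type u}

theorem isUPoint_iff {n : ℕ} {R : Type v} [CommRing R] (P : SkewPol p K R) :
    IsUPoint p K n P ↔ P.coeff 0 = 1 ∧ ∀ i, 1 ≤ i → P.coeff i ^ p ^ (n + 1 - i) = 0 := by
  constructor
  · rintro ⟨h0, h1, h2⟩
    refine ⟨h0, fun i hi => ?_⟩
    rcases le_or_gt i n with h | h
    · rw [show n + 1 - i = n - i + 1 by omega]; exact h1 i hi h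
    · rw [show n + 1 - i = 0 by omega, h2 i h]; simp
  · rintro ⟨h0, h1⟩
    refine ⟨h0, fun i hi h => ?_, fun i h => ?_⟩
    · rw [show n - i + 1 = n + 1 - i by omega]; exact h1 i hi
    · have := h1 i (by omega)
      rwa [show n + 1 - i = 0 by omega, pow_zero, pow_one] at this

theorem sum_pow_pow (p : ℕ) [Fact p.Prime] (K : Type u) [Field K] [CharP K p]
    (R : Type v) [CommRing R] [Algebra K R] {ι : Type*} (s : Finset ι) (f : ι → R) (k : ℕ) :
    (∑ i ∈ s, f i) ^ p ^ k = ∑ i ∈ s, f i ^ p ^ k := by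
  classical
  induction s using Finset.induction_on with
  | empty => simpa using zero_pow_pow p R k
  | insert a s ha ih => rw [Finset.sum_insert ha, Finset.sum_insert ha, add_pow_pow p K, ih]

theorem pow_pow_eq_zero_of_le (p : ℕ) [Fact p.Prime] {R : Type v} [CommRing R] {a : R} {k l : ℕ}
    (h : a ^ p ^ k = 0) (hkl : k ≤ l) : a ^ p ^ l = 0 :=
  pow_eq_zero_of_le (Nat.pow_le_pow_right (Nat.Prime.pos Fact.out) hkl) h

/-- A summand `a * b ^ p ^ i` in degree `i + j`, `j ≥ 1`, satisfies the nilpotency condition. -/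
theorem term_pow_eq_zero (p : ℕ) [Fact p.Prime] {R : Type v} [CommRing R] (n i j : ℕ) (a b : R)
    (hb : b ^ p ^ (n + 1 - j) = 0) : (a * b ^ p ^ i) ^ p ^ (n + 1 - (i + j)) = 0 := by
  rw [mul_pow, ← pow_mul, ← pow_add, pow_pow_eq_zero_of_le p hb (by omega), mul_zero]

variable [Fact p.Prime] [Field K] [CharP K p]

theorem IsUPoint.one {n : ℕ} {R : Type v} [CommRing R] [Algebra K R] :
    IsUPoint p K n (1 : SkewPol p K R) := by
  rw [isUPoint_iff]
  refine ⟨by simp [SkewPol.coeff_one], fun i hi => ?_⟩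
  rw [SkewPol.coeff_one, if_neg (by omega), zero_pow_pow]

theorem IsUPoint.mul {n : ℕ} {R : Type v} [CommRing R] [Algebra K R] {P Q : SkewPol p K R}
    (hP : IsUPoint p K n P) (hQ : IsUPoint p K n Q) : IsUPoint p K n (P * Q) := by
  rw [isUPoint_iff] at *
  refine ⟨by simp [SkewPol.coeff_mul, hP.1, hQ.1], fun k hk => ?_⟩
  rw [SkewPol.coeff_mul, sum_pow_pow p K]
  refine Finset.sum_eq_zero fun ij hij => ?_
  obtain ⟨i, j⟩ := ij
  obtain rfl : i + j = k := Finset.HasAntidiagonal.mem_antidiagonal.mp hij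
  rcases Nat.eq_zero_or_pos j with rfl | hj
  · simpa [hQ.1] using hP.2 i hk
  · exact term_pow_eq_zero p n i j _ _ (hQ.2 j hj)

theorem IsUPoint.of_mul_eq_one {n : ℕ} {R : Type v} [CommRing R] [Algebra K R]
    {P Q : SkewPol p K R} (hP : IsUPoint p K n P) (h : P * Q = 1) : IsUPoint p K n Q := by
  rw [isUPoint_iff] at *
  have hc : ∀ k, ∑ ij ∈ Finset.HasAntidiagonal.antidiagonal k, P.coeff ij.1 * Q.coeff ij.2 ^ p ^ ij.1
      = if k = 0 then 1 else 0 := fun k => by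
    rw [← SkewPol.coeff_mul, h, SkewPol.coeff_one]
  have h0 : Q.coeff 0 = 1 := by simpa [hP.1] using hc 0
  refine ⟨h0, fun k => ?_⟩
  induction k using Nat.strong_induction_on with
  | _ k ih =>
    intro hk
    obtain ⟨m, rfl⟩ : ∃ m, k = m + 1 := ⟨k - 1, by omega⟩
    have h1 := hc (m + 1)
    rw [Finset.Nat.sum_antidiagonal_succ, if_neg (by omega), hP.1, one_mul, pow_zero, pow_one] at h1
    have h2 := congrArg (fun a => a ^ p ^ (n + 1 - (m + 1))) h1
    simp only [add_pow_pow p K, sum_pow_pow p K, zero_pow_pow] at h2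
    rw [Finset.sum_eq_zero, add_zero] at h2
    · exact h2
    · rintro ⟨i, j⟩ hij
      have hij' : i + j = m := Finset.HasAntidiagonal.mem_antidiagonal.mp hij
      have e : m + 1 = (i + 1) + j := by omega
      rcases Nat.eq_zero_or_pos j with rfl | hj
      · rw [h0, one_pow, mul_one, e]; exact hP.2 (i + 1) (by omega)
      · rw [e]; exact term_pow_eq_zero p n (i + 1) j _ _ (ih j (by omega) hj)

theorem IsUPoint.map {n : ℕ} {R S : Type v} [CommRing R] [Algebra K R] [CommRing S] [Algebra K S]
    (f : R →ₐ[K] S) {P : SkewPol p K R} (hP : IsUPoint p K n P) :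
    IsUPoint p K n (SkewPol.map f P) := by
  rw [isUPoint_iff] at *
  refine ⟨by rw [SkewPol.coeff_map, hP.1, map_one], fun i hi => ?_⟩
  rw [SkewPol.coeff_map, ← map_pow, hP.2 i hi, map_zero]

variable (p K)

/-- The subgroup `U_n(R)` of the unit group of `R[F; σ]`. -/
def UPoints (n : ℕ) (R : Type v) [CommRing R] [Algebra K R] : Subgroup (SkewPol p K R)ˣ where
  carrier := {P | IsUPoint p K n (P : SkewPol p K R)}
  one_mem' := IsUPoint.one
  mul_mem' hP hQ := IsUPoint.mul hP hQ
  inv_mem' {P} hP := IsUPoint.of_mul_eq_one hP P.mul_inv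

/-- The additive group `α_{p^m}(R)` of all `a ∈ R` with `a ^ p ^ m = 0`. -/
def alphaPoints (m : ℕ) (R : Type v) [CommRing R] [Algebra K R] : AddSubgroup R where
  carrier := {a | a ^ p ^ m = 0}
  zero_mem' := zero_pow_pow p R m
  add_mem' {a b} ha hb := by
    change (a + b) ^ p ^ m = 0
    rw [add_pow_pow p K, show a ^ p ^ m = 0 from ha, show b ^ p ^ m = 0 from hb, add_zero]
  neg_mem' {a} ha := by
    change (-a) ^ p ^ m = 0
    rw [neg_pow, show a ^ p ^ m = 0 from ha, mul_zero]

end Groups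

/-! ### Group schemes as group-valued functors on `K`-algebras -/

section Functors

/-- Group-valued functors on the category of commutative `K`-algebras. -/
abbrev GroupFunctor (K : Type u) [Field K] := CommAlgCat.{u} K ⥤ GrpCat.{u}

/-- An affine group scheme over `K` is a group-valued functor on `K`-algebras whose underlying
set-valued functor is isomorphic to `Hom_K(A, -)` for some `K`-algebra `A`. -/
def GroupFunctor.IsAffineGroupScheme {K : Type u} [Field K] (G : GroupFunctor K) : Prop :=
  (G ⋙ forget GrpCat).IsCorepresentable

variable (p : ℕ) [Fact p.Prime] (K : Type u) [Field K] [CharP K p]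

/-- The group-valued functor `R ↦ U_n(R)`. -/
def U (n : ℕ) : GroupFunctor K where
  obj R := GrpCat.of (UPoints p K n R)
  map {R S} f := GrpCat.ofHom
    (((Units.map (SkewPol.map f.hom)).comp (UPoints p K n R).subtype).codRestrict (UPoints p K n S)
      fun P => IsUPoint.map f.hom P.2)
  map_id R := by
    ext x
    refine SkewPol.ext (R := R) (p := p) (K := K) fun i => ?_
    rfl
  map_comp {R S T} f g := by
    ext x
    refine SkewPol.ext (R := T) (p := p) (K := K) fun i => ?_
    rfl

/-- The coefficient `λ_i` of the point `1 + ∑ λ_i F ^ i` of `U_n(R)`. -/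
def U.coeff {n : ℕ} {R : CommAlgCat.{u} K} (x : (U p K n).obj R) (i : ℕ) : R :=
  let P : UPoints p K n R := x
  SkewPol.coeff (P : (SkewPol p K R)ˣ).val i

/-- The group-valued functor `R ↦ α_{p^m}(R)`, written multiplicatively. -/
def alpha (m : ℕ) : GroupFunctor K where
  obj R := GrpCat.of (Multiplicative (alphaPoints p K m R))
  map {R S} f := GrpCat.ofHom (AddMonoidHom.toMultiplicative
    (((f.hom : R →+ S).comp (alphaPoints p K m R).subtype).codRestrict (alphaPoints p K m S)
      fun a => by
        change (f.hom (a : R)) ^ p ^ m = 0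
        rw [← map_pow, show (a : R) ^ p ^ m = 0 from a.2, map_zero]))
  map_id _ := rfl
  map_comp _ _ := rfl

end Functors

/-! ### Closed subgroup schemes, quotients, central series -/

section Subgroups

variable {K : Type u} [Field K]

/-- A closed subgroup scheme of `G`: a subgroup functor `H` that is a closed subfunctor. The latter
means that for every point `x ∈ G(R)` there is an ideal `I` of `R` such that the image of `x` under
a homomorphism `R → S` belongs to `H(S)` exactly when `R → S` vanishes on `I`. -/
structure ClosedSubgroup (G : GroupFunctor K) where
  pts : ∀ R : CommAlgCat.{u} K, Subgroup (G.obj R)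
  map_mem : ∀ {R S : CommAlgCat.{u} K} (f : R ⟶ S) {x : G.obj R}, x ∈ pts R → G.map f x ∈ pts S
  closed : ∀ (R : CommAlgCat.{u} K) (x : G.obj R), ∃ I : Ideal R,
    ∀ (S : CommAlgCat.{u} K) (f : R ⟶ S), G.map f x ∈ pts S ↔ ∀ a ∈ I, f a = 0

variable {G : GroupFunctor K}

/-- A closed subgroup scheme, as a group-valued functor in its own right. -/
def ClosedSubgroup.toFunctor (H : ClosedSubgroup G) : GroupFunctor K where
  obj R := GrpCat.of (H.pts R)
  map {R S} f := GrpCat.ofHom (((G.map f).hom.comp (H.pts R).subtype).codRestrict (H.pts S)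
    fun x => H.map_mem f x.2)
  map_id R := by
    ext x
    change G.map (𝟙 R) (x : G.obj R) = (x : G.obj R)
    simp
  map_comp {R S T} f g := by
    ext x
    change G.map (f ≫ g) (x : G.obj R) = G.map g (G.map f (x : G.obj R))
    simp

/-- `Q` is the quotient group scheme `H / N` (the fppf quotient sheaf): `Q` is an affine group
scheme and there is a homomorphism `π : H → Q` with kernel `N` which is an epimorphism of fppf
sheaves, that is, each point of `Q` lifts to `H` after a faithfully flat extension of finite
presentation. -/
def IsQuotient (H N : ClosedSubgroup G) (Q : GroupFunctor K) : Prop :=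
  Q.IsAffineGroupScheme ∧ (∀ R, N.pts R ≤ H.pts R) ∧ ∃ π : H.toFunctor ⟶ Q,
    (∀ (R : CommAlgCat.{u} K) (x : H.pts R), π.app R x = 1 ↔ (x : G.obj R) ∈ N.pts R) ∧
    ∀ (R : CommAlgCat.{u} K) (q : Q.obj R), ∃ (R' : CommAlgCat.{u} K) (f : R ⟶ R'),
      f.hom.toRingHom.FaithfullyFlat ∧ f.hom.toRingHom.FinitePresentation ∧
        ∃ x : H.pts R', π.app R' x = Q.map f q

/-- The points of the upper central series `Z_0 ⊆ Z_1 ⊆ ⋯` of `G`: we have `Z_0 = {1}`, and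
`x ∈ G(R)` belongs to `Z_{s+1}(R)` if for all flat ring extensions `R ⊆ R'` it commutes with all
members of `G(R')` up to elements of `Z_s(R')`. -/
def upperCentral (G : GroupFunctor K) : ℕ → ∀ R : CommAlgCat.{u} K, Set (G.obj R)
  | 0, _ => {1}
  | s + 1, R => {x | ∀ (R' : CommAlgCat.{u} K) (f : R ⟶ R'),
      f.hom.toRingHom.Flat → Function.Injective f.hom →
        ∀ g : G.obj R', G.map f x * g * (G.map f x)⁻¹ * g⁻¹ ∈ upperCentral G s R'}

/-- The commutator subgroup scheme `[G, Γ]`: the smallest closed subgroup scheme of `G` through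
which the commutator map `G × Γ → G` factors. It is constructed as the intersection of all closed
subgroup schemes with this property. -/
def commutatorClosure (Γ : ClosedSubgroup G) : ClosedSubgroup G where
  pts R := ⨅ H ∈ {H : ClosedSubgroup G | ∀ (S : CommAlgCat.{u} K) (g x : G.obj S),
    x ∈ Γ.pts S → g * x * g⁻¹ * x⁻¹ ∈ H.pts S}, H.pts R
  map_mem f x hx := by
    simp only [Subgroup.mem_iInf] at hx ⊢
    exact fun H hH => H.map_mem f (hx H hH)
  closed R x := by
    choose I hI using fun H : ClosedSubgroup G => H.closed R x
    refine ⟨sSup (I '' {H : ClosedSubgroup G | ∀ (S : CommAlgCat.{u} K) (g x : G.obj S),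
      x ∈ Γ.pts S → g * x * g⁻¹ * x⁻¹ ∈ H.pts S}), fun S f => ?_⟩
    have key : ∀ J : Ideal R, (∀ a ∈ J, f a = 0) ↔ J ≤ RingHom.ker f.hom := fun J => Iff.rfl
    simp only [Subgroup.mem_iInf, key, sSup_le_iff, Set.forall_mem_image] at hI ⊢
    exact forall₂_congr fun H _ => hI H S f

/-- The lower central series `Γ^0 = G`, `Γ^{r+1} = [G, Γ^r]` of closed subgroup schemes. -/
def lowerCentral (G : GroupFunctor K) : ℕ → ClosedSubgroup G
  | 0 =>
    { pts := fun _ => ⊤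
      map_mem := fun _ _ _ => Subgroup.mem_top _
      closed := fun _ _ => ⟨⊥, fun _ f => by simp⟩ }
  | r + 1 => commutatorClosure (lowerCentral G r)

end Subgroups

end

end FrobeniusSkew

/-! Everything is read off from the filtration of `U_n` by the congruence subgroups `C_k` of points
congruent to 1 up to degree `k`, with `G_r = C_{n-r}`.

In a product with an element of `C_k`, coefficients in degrees 1 to `k + 1` add up, because all
mixed terms vanish there. So commuting with `C_k` costs nothing through degree `k + 1`: commutators
lie in `C_{k+1}` (`AgreeUpTo.mul_comm`), and the coefficient of `F ^ (k + 1)` is a homomorphism on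
`C_k` with kernel `C_{k+1}`. It has the section `a ↦ 1 + a F ^ (k + 1)`, which gives the quotients.

That the two series move no faster comes from the Frobenius twist. For the upper series, if `x`
commutes with `1 + μ F` through degree `i + 1`, then `λ_i μ ^ p ^ i = μ λ_i ^ p`; for generic `μ`
this forces `λ_i = 0` when `1 ≤ i < n` (`coeff_eq_zero_of_commutators`).

For the lower series, the commutator of `1 + b F` and `1 + a F ^ m` has leading coefficient `b a ^ p
- a b ^ p ^ m`. For generic `a`, `b` this element satisfies no more relations than a generic
coefficient of `F ^ (m + 1)` (`X_pow_dvd_of_aeval_eq_zero`), so a closed subgroup containing the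
commutators must contain the universal point `1 + ξ F ^ (m + 1)`, once it contains the higher
congruence subgroup (`single_mem_of_commutators_mem`). Descending induction on the degree finishes
the argument. -/

namespace FrobeniusSkew

noncomputable section

/-! ### Congruence of skew polynomials modulo powers of `F` -/

section Congruence

variable {p : ℕ} {K : Type u} {R : Type v} [CommRing R]

/-- The skew polynomial `1 + ∑_{i = 1}^n c_i F ^ i`. -/
def SkewPol.ofCoeffs (n : ℕ) (c : ℕ → R) : SkewPol p K R :=
  SkewMonoidAlgebra.ofCoeff (Finsupp.onFinset (α := Multiplicative ℕ)
    (Finset.range (n + 1) : Finset ℕ)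
    (fun i => if i.toAdd = 0 then 1 else if i.toAdd ≤ n then c i.toAdd else 0)
    (fun i hi => by
      refine Finset.mem_range.mpr ?_
      by_contra h
      change ¬ (i.toAdd < n + 1) at h
      rw [if_neg (by omega), if_neg (by omega)] at hi
      exact hi rfl))

theorem SkewPol.coeff_ofCoeffs (n : ℕ) (c : ℕ → R) (i : ℕ) :
    (SkewPol.ofCoeffs n c : SkewPol p K R).coeff i
      = if i = 0 then 1 else if i ≤ n then c i else 0 :=
  rfl

/-- The skew polynomials `P` and `Q` have the same coefficients in degrees up to `k`. -/
def AgreeUpTo (k : ℕ) (P Q : SkewPol p K R) : Prop :=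
  ∀ i ≤ k, P.coeff i = Q.coeff i

theorem AgreeUpTo.rfl {k : ℕ} {P : SkewPol p K R} : AgreeUpTo k P P := fun _ _ => Eq.refl _

theorem AgreeUpTo.symm {k : ℕ} {P Q : SkewPol p K R} (h : AgreeUpTo k P Q) : AgreeUpTo k Q P :=
  fun i hi => (h i hi).symm

theorem AgreeUpTo.mono {k l : ℕ} {P Q : SkewPol p K R} (h : AgreeUpTo l P Q) (hkl : k ≤ l) :
    AgreeUpTo k P Q :=
  fun i hi => h i (hi.trans hkl)

theorem IsUPoint.coeff_eq_zero_of_lt {n : ℕ} {P : SkewPol p K R} (hP : IsUPoint p K n P) {i : ℕ}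
    (hi : n < i) : P.coeff i = 0 :=
  hP.2.2 i hi

theorem IsUPoint.eq_of_agreeUpTo {n : ℕ} {P Q : SkewPol p K R} (hP : IsUPoint p K n P)
    (hQ : IsUPoint p K n Q) (h : AgreeUpTo n P Q) : P = Q := by
  refine SkewPol.ext fun i => ?_
  rcases le_or_gt i n with hi | hi
  · exact h i hi
  · rw [hP.coeff_eq_zero_of_lt hi, hQ.coeff_eq_zero_of_lt hi]

variable [Fact p.Prime]

theorem SkewPol.isUPoint_ofCoeffs {n : ℕ} {c : ℕ → R}
    (hc : ∀ i, 1 ≤ i → i ≤ n → c i ^ p ^ (n + 1 - i) = 0) :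
    IsUPoint p K n (SkewPol.ofCoeffs n c : SkewPol p K R) := by
  rw [isUPoint_iff]
  refine ⟨by simp [SkewPol.coeff_ofCoeffs], fun i hi => ?_⟩
  rw [SkewPol.coeff_ofCoeffs, if_neg (by omega)]
  split_ifs with h
  · exact hc i hi h
  · exact zero_pow_pow p R _

variable [Field K] [CharP K p] [Algebra K R]

theorem AgreeUpTo.mul {k : ℕ} {P P' Q Q' : SkewPol p K R} (h : AgreeUpTo k P P')
    (h' : AgreeUpTo k Q Q') : AgreeUpTo k (P * Q) (P' * Q') := by
  intro i hi
  rw [SkewPol.coeff_mul, SkewPol.coeff_mul]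
  refine Finset.sum_congr (Eq.refl _) fun jl hjl => ?_
  have := Finset.HasAntidiagonal.mem_antidiagonal.mp hjl
  rw [h _ (by omega), h' _ (by omega)]

/-- If all mixed terms in degree `i` vanish, then the coefficient in degree `i` is additive. -/
theorem SkewPol.coeff_mul_of_mixed {P Q : SkewPol p K R} (hP : P.coeff 0 = 1)
    (hQ : Q.coeff 0 = 1) {i : ℕ} (hi : i ≠ 0)
    (h : ∀ j l, j + l = i → j ≠ 0 → l ≠ 0 → P.coeff j * Q.coeff l ^ p ^ j = 0) :
    (P * Q).coeff i = P.coeff i + Q.coeff i := by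
  rw [SkewPol.coeff_mul, Finset.sum_eq_add_of_mem (i, 0) (0, i)]
  · simp [hP, hQ]
  · simp
  · simp
  · simpa [Prod.ext_iff] using fun h => absurd h hi
  · rintro ⟨j, l⟩ hjl ⟨h1, h2⟩
    have hjl' : j + l = i := Finset.HasAntidiagonal.mem_antidiagonal.mp hjl
    refine h j l hjl' ?_ ?_
    · rintro rfl
      exact h2 (by simpa using hjl')
    · rintro rfl
      exact h1 (by simpa using hjl')

/-- A mixed term in degree `i ≤ k + 1` involves only coefficients of `P` in degrees 1 to `k`. The
range thus reaches one degree past the agreement, which is what raises the filtration under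
commutators. -/
theorem SkewPol.coeff_mul_of_agreeUpTo_one_left {k : ℕ} {P Q : SkewPol p K R}
    (h : AgreeUpTo k P 1) (hQ : Q.coeff 0 = 1) {i : ℕ} (h0 : i ≠ 0) (hi : i ≤ k + 1) :
    (P * Q).coeff i = P.coeff i + Q.coeff i := by
  refine coeff_mul_of_mixed (by simp [h 0 (Nat.zero_le _), coeff_one]) hQ h0 fun j l hjl hj hl => ?_
  rw [h j (by omega), coeff_one, if_neg hj, zero_mul]

theorem SkewPol.coeff_mul_of_agreeUpTo_one_right {k : ℕ} {P Q : SkewPol p K R}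
    (hP : P.coeff 0 = 1) (h : AgreeUpTo k Q 1) {i : ℕ} (h0 : i ≠ 0) (hi : i ≤ k + 1) :
    (P * Q).coeff i = P.coeff i + Q.coeff i := by
  refine coeff_mul_of_mixed hP (by simp [h 0 (Nat.zero_le _), coeff_one]) h0 fun j l hjl hj hl => ?_
  rw [h l (by omega), coeff_one, if_neg hl, zero_pow_pow, mul_zero]

theorem SkewPol.coeff_mul_zero {P Q : SkewPol p K R} :
    (P * Q).coeff 0 = P.coeff 0 * Q.coeff 0 := by
  simp [SkewPol.coeff_mul]

theorem AgreeUpTo.mul_comm {k : ℕ} {P Q : SkewPol p K R} (h : AgreeUpTo k P 1)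
    (hQ : Q.coeff 0 = 1) : AgreeUpTo (k + 1) (P * Q) (Q * P) := by
  intro i hi
  rcases eq_or_ne i 0 with rfl | h0
  · rw [SkewPol.coeff_mul_zero, SkewPol.coeff_mul_zero, _root_.mul_comm]
  · rw [SkewPol.coeff_mul_of_agreeUpTo_one_left h hQ h0 hi,
      SkewPol.coeff_mul_of_agreeUpTo_one_right hQ h h0 hi, add_comm]

/-- Inversion by successive approximation: the error `e` in degree `k + 1` is removed by the factor
`1 - e F ^ (k + 1)`. This factor is admissible because `e` is a coefficient of a product of two
admissible elements. -/
theorem IsUPoint.exists_mul_agreeUpTo_one {n : ℕ} {P : SkewPol p K R} (hP : IsUPoint p K n P)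
    (k : ℕ) : ∃ Q : SkewPol p K R, IsUPoint p K n Q ∧ AgreeUpTo k (P * Q) 1 := by
  induction k with
  | zero =>
    refine ⟨1, IsUPoint.one, fun i hi => ?_⟩
    obtain rfl : i = 0 := by omega
    rw [mul_one, hP.1, SkewPol.coeff_one, if_pos (Eq.refl 0)]
  | succ k ih =>
    obtain ⟨Q, hQ, h⟩ := ih
    have hPQ := (isUPoint_iff _).mp (hP.mul hQ)
    set e := (P * Q).coeff (k + 1) with he
    let S : SkewPol p K R := SkewPol.ofCoeffs n fun i => if i = k + 1 then -e else 0
    have hS : IsUPoint p K n S := SkewPol.isUPoint_ofCoeffs fun i hi _ => by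
      split_ifs with h1
      · subst h1
        rw [neg_pow, hPQ.2 _ hi, mul_zero]
      · exact zero_pow_pow p R _
    refine ⟨Q * S, hQ.mul hS, fun i hi => ?_⟩
    rw [← mul_assoc]
    rcases eq_or_ne i 0 with rfl | h0
    · rw [SkewPol.coeff_mul_zero, (hP.mul hQ).1, hS.1, mul_one, SkewPol.coeff_one,
        if_pos (Eq.refl 0)]
    · rw [SkewPol.coeff_mul_of_agreeUpTo_one_left h hS.1 h0 hi, SkewPol.coeff_ofCoeffs,
        if_neg h0]
      rcases eq_or_ne i (k + 1) with rfl | h1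
      · rw [SkewPol.coeff_one, if_neg h0, if_pos (Eq.refl _), ← he]
        -- If `k + 1 > n`, the correcting factor is trivial, but then `e` is already zero.
        split_ifs with h2
        · exact add_neg_cancel e
        · rw [add_zero, he, (hP.mul hQ).coeff_eq_zero_of_lt (by omega)]
      · rw [h i (by omega), if_neg h1, ite_self, add_zero]

theorem IsUPoint.exists_mul_eq_one {n : ℕ} {P : SkewPol p K R} (hP : IsUPoint p K n P) :
    ∃ Q : SkewPol p K R, IsUPoint p K n Q ∧ P * Q = 1 := by
  obtain ⟨Q, hQ, h⟩ := hP.exists_mul_agreeUpTo_one n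
  exact ⟨Q, hQ, (hP.mul hQ).eq_of_agreeUpTo IsUPoint.one h⟩

theorem IsUPoint.isUnit {n : ℕ} {P : SkewPol p K R} (hP : IsUPoint p K n P) : IsUnit P := by
  obtain ⟨Q, hQ, h⟩ := hP.exists_mul_eq_one
  obtain ⟨S, -, h'⟩ := hQ.exists_mul_eq_one
  obtain rfl : P = S := left_inv_eq_right_inv h h'
  exact ⟨⟨P, Q, h, h'⟩, Eq.refl _⟩

end Congruence

/-! ### Points of `U_n` -/

section Points

variable {p : ℕ} [Fact p.Prime] {K : Type u} [Field K] [CharP K p] {n : ℕ}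

/-- A point of `U_n(R)` as a skew polynomial. -/
def U.val {R : CommAlgCat.{u} K} : (U p K n).obj R →* SkewPol p K R :=
  (Units.coeHom _).comp (UPoints p K n R).subtype

variable {R S : CommAlgCat.{u} K}

theorem U.coeff_eq (x : (U p K n).obj R) (i : ℕ) : U.coeff p K x i = (U.val x).coeff i := rfl

theorem U.isUPoint_val (x : (U p K n).obj R) : IsUPoint p K n (U.val x) :=
  Subtype.prop (p := fun y => y ∈ UPoints p K n R) x

theorem U.coeff_val_zero (x : (U p K n).obj R) : (U.val x).coeff 0 = 1 :=
  (U.isUPoint_val x).1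

theorem U.val_map (f : R ⟶ S) (x : (U p K n).obj R) (i : ℕ) :
    (U.val ((U p K n).map f x)).coeff i = f ((U.val x).coeff i) :=
  rfl

theorem U.val_injective : Function.Injective (U.val : (U p K n).obj R →* SkewPol p K R) := by
  intro x y h
  exact Subtype.ext (Units.ext h)

theorem U.ext_of_agreeUpTo {x y : (U p K n).obj R} (h : AgreeUpTo n (U.val x) (U.val y)) : x = y :=
  U.val_injective ((U.isUPoint_val x).eq_of_agreeUpTo (U.isUPoint_val y) h)

/-- The point `1 + ∑_{i = 1}^n c_i F ^ i` of `U_n(R)`. -/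
def U.mk (c : ℕ → R) (hc : ∀ i, 1 ≤ i → i ≤ n → c i ^ p ^ (n + 1 - i) = 0) : (U p K n).obj R :=
  let x : UPoints p K n R :=
    ⟨(SkewPol.isUPoint_ofCoeffs (K := K) hc).isUnit.unit, SkewPol.isUPoint_ofCoeffs hc⟩
  x

theorem U.coeff_mk (c : ℕ → R) (hc : ∀ i, 1 ≤ i → i ≤ n → c i ^ p ^ (n + 1 - i) = 0) (i : ℕ) :
    (U.val (U.mk c hc : (U p K n).obj R)).coeff i
      = if i = 0 then 1 else if i ≤ n then c i else 0 :=
  rfl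

theorem U.agreeUpTo_iff_div {k : ℕ} {x y : (U p K n).obj R} :
    AgreeUpTo k (U.val (x * y⁻¹)) 1 ↔ AgreeUpTo k (U.val x) (U.val y) := by
  constructor
  · intro h
    simpa [← map_mul] using h.mul (AgreeUpTo.rfl (P := U.val y))
  · intro h
    simpa [← map_mul] using h.mul (AgreeUpTo.rfl (P := U.val y⁻¹))

/-- The commutator is `(x g) (g x)⁻¹`, so no coefficient of an inverse ever has to be computed. -/
theorem U.agreeUpTo_commutator_iff {k : ℕ} {x g : (U p K n).obj R} :
    AgreeUpTo k (U.val (x * g * x⁻¹ * g⁻¹)) 1 ↔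
      AgreeUpTo k (U.val x * U.val g) (U.val g * U.val x) := by
  rw [mul_assoc (x * g), ← mul_inv_rev, U.agreeUpTo_iff_div, map_mul, map_mul]

/-- The point `1 + a F ^ d` of `U_n(R)`. -/
def U.single {d : ℕ} {a : R} (ha : a ^ p ^ (n + 1 - d) = 0) : (U p K n).obj R :=
  U.mk (fun i => if i = d then a else 0) fun i _ _ => by
    split_ifs with h
    · rw [h, ha]
    · exact zero_pow_pow p R _

theorem U.coeff_single {d : ℕ} {a : R} (ha : a ^ p ^ (n + 1 - d) = 0) (hd : d ≤ n) (i : ℕ) :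
    (U.val (U.single ha : (U p K n).obj R)).coeff i
      = if i = 0 then 1 else if i = d then a else 0 := by
  rw [U.single, U.coeff_mk]
  split_ifs <;> first | rfl | omega

/-- The closed subgroup scheme of all points `1 + ∑_{i > k} λ_i F ^ i` of `U_n`. -/
def congruenceSubgroup (p : ℕ) [Fact p.Prime] (K : Type u) [Field K] [CharP K p] (n k : ℕ) :
    ClosedSubgroup (U p K n) where
  pts R :=
    { carrier := {x | AgreeUpTo k (U.val x) 1}
      one_mem' := by simpa using AgreeUpTo.rfl
      mul_mem' := fun {x y} hx hy => by simpa using hx.mul hy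
      inv_mem' := fun {x} hx => by
        have := (AgreeUpTo.rfl (P := U.val x⁻¹)).mul hx.symm
        simpa [← map_mul] using this }
  map_mem f x hx i hi := by
    rw [U.val_map, hx i hi, SkewPol.coeff_one, SkewPol.coeff_one]
    split_ifs <;> simp
  closed R x := by
    -- Degree 0 is left out: that coefficient is always 1 and imposes no condition.
    refine ⟨Ideal.span {a | ∃ i ≤ k, i ≠ 0 ∧ (U.val x).coeff i = a}, fun S f => ?_⟩
    have key : (∀ a ∈ Ideal.span {a | ∃ i ≤ k, i ≠ 0 ∧ (U.val x).coeff i = a}, f a = 0) ↔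
        Ideal.span {a | ∃ i ≤ k, i ≠ 0 ∧ (U.val x).coeff i = a} ≤ RingHom.ker f.hom := Iff.rfl
    rw [key, Ideal.span_le]
    constructor
    · rintro h _ ⟨i, hi, h0, rfl⟩
      have := h i hi
      rwa [U.val_map, SkewPol.coeff_one, if_neg h0] at this
    · intro h i hi
      rcases eq_or_ne i 0 with rfl | h0
      · rw [U.coeff_val_zero, SkewPol.coeff_one, if_pos rfl]
      · rw [U.val_map, SkewPol.coeff_one, if_neg h0]
        exact h ⟨i, hi, h0, rfl⟩

theorem mem_congruenceSubgroup {k : ℕ} {x : (U p K n).obj R} :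
    x ∈ (congruenceSubgroup p K n k).pts R ↔ AgreeUpTo k (U.val x) 1 :=
  Iff.rfl

theorem mem_congruenceSubgroup_iff_coeff {k : ℕ} {x : (U p K n).obj R} :
    x ∈ (congruenceSubgroup p K n k).pts R ↔ ∀ i, 1 ≤ i → i ≤ k → U.coeff p K x i = 0 := by
  rw [mem_congruenceSubgroup]
  constructor
  · intro h i hi hik
    rw [U.coeff_eq, h i hik, SkewPol.coeff_one, if_neg (by omega)]
  · intro h i hi
    rcases Nat.eq_zero_or_pos i with rfl | h0
    · rw [U.coeff_val_zero, SkewPol.coeff_one, if_pos rfl]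
    · rw [SkewPol.coeff_one, if_neg (by omega)]
      exact h i h0 hi

theorem commutator_mem_congruenceSubgroup {k : ℕ} {x : (U p K n).obj R} (g : (U p K n).obj R)
    (hx : x ∈ (congruenceSubgroup p K n k).pts R) :
    x * g * x⁻¹ * g⁻¹ ∈ (congruenceSubgroup p K n (k + 1)).pts R := by
  rw [mem_congruenceSubgroup, U.agreeUpTo_commutator_iff]
  exact AgreeUpTo.mul_comm hx (U.coeff_val_zero g)

theorem commutator_mem_congruenceSubgroup' {k : ℕ} {x : (U p K n).obj R} (g : (U p K n).obj R)
    (hx : x ∈ (congruenceSubgroup p K n k).pts R) :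
    g * x * g⁻¹ * x⁻¹ ∈ (congruenceSubgroup p K n (k + 1)).pts R := by
  rw [mem_congruenceSubgroup, U.agreeUpTo_commutator_iff]
  exact (AgreeUpTo.mul_comm hx (U.coeff_val_zero g)).symm

end Points

/-! ### Truncated polynomial algebras -/

section Truncated

open Polynomial

theorem mk_X_pow_eq_zero_iff {R : Type v} [CommRing R] {N : ℕ} {q : R[X]} :
    AdjoinRoot.mk (X ^ N : R[X]) q = 0 ↔ ∀ d < N, q.coeff d = 0 := by
  rw [AdjoinRoot.mk_eq_zero, X_pow_dvd_iff]

theorem root_X_pow_pow {R : Type v} [CommRing R] (N : ℕ) :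
    AdjoinRoot.root (X ^ N : R[X]) ^ N = 0 := by
  rw [← AdjoinRoot.mk_X, ← map_pow, AdjoinRoot.mk_self]

theorem of_X_pow_injective {R : Type v} [CommRing R] {N : ℕ} (hN : 0 < N) :
    Function.Injective (AdjoinRoot.of (X ^ N : R[X])) := by
  rw [injective_iff_map_eq_zero]
  intro r hr
  rw [← AdjoinRoot.mk_C, mk_X_pow_eq_zero_iff] at hr
  simpa using hr 0 hN

/-- The extension is free because `X ^ N` is monic. Hence adjoining a generic nilpotent is an
allowed test extension in the upper central series. -/
theorem of_X_pow_flat {R : Type v} [CommRing R] (N : ℕ) :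
    (AdjoinRoot.of (X ^ N : R[X])).Flat := by
  have := (monic_X_pow (R := R) N).free_adjoinRoot
  rw [← AdjoinRoot.algebraMap_eq, RingHom.flat_algebraMap_iff]
  infer_instance

/-- The substitution `x ↦ b a ^ e - a b ^ q` from `k[x] / (x ^ N)` to
`k[a, b] / (a ^ M₁, b ^ M₂)` is injective for suitable exponents. -/
theorem X_pow_dvd_of_aeval_eq_zero {k : Type u} [Field k] {N M₁ M₂ e q : ℕ} (hq : 2 ≤ q)
    (h₁ : ∀ i < N, e * i < M₁) (h₂ : N ≤ M₂) {P : k[X]}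
    (hP : aeval (AdjoinRoot.root (X ^ M₂ : (AdjoinRoot (X ^ M₁ : k[X]))[X]) *
        AdjoinRoot.of _ (AdjoinRoot.root _) ^ e -
      AdjoinRoot.of _ (AdjoinRoot.root _) * AdjoinRoot.root _ ^ q) P = 0) :
    X ^ N ∣ P := by
  classical
  by_contra hdvd
  rw [X_pow_dvd_iff] at hdvd
  push Not at hdvd
  -- Let `i < N` be the order of vanishing of `P`, so that `P = X ^ i * Q` with `Q` of nonzero
  -- constant term.
  obtain ⟨hiN, hi0⟩ := Nat.find_spec hdvd
  have hmin := fun j => Nat.find_min hdvd (m := j)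
  generalize Nat.find hdvd = i at hiN hi0 hmin
  obtain ⟨Q, rfl⟩ : X ^ i ∣ P := X_pow_dvd_iff.mpr fun d hd => by
    by_contra h
    exact hmin d hd ⟨hd.trans hiN, h⟩
  set a : AdjoinRoot (X ^ M₁ : k[X]) := AdjoinRoot.root _ with ha
  -- The substituted element is `b h(b)` with `h(0) = a ^ e`, since `q ≥ 2`. So the coefficient of
  -- `b ^ i` in the image of `P` is `a ^ (e i) Q(0)`, which survives because `i < M₂` and `e i <
  -- M₁`.
  let h : (AdjoinRoot (X ^ M₁ : k[X]))[X] := C (a ^ e) - C a * X ^ (q - 1)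
  have hf : AdjoinRoot.root (X ^ M₂ : (AdjoinRoot (X ^ M₁ : k[X]))[X]) *
        AdjoinRoot.of _ a ^ e - AdjoinRoot.of _ a * AdjoinRoot.root _ ^ q =
      AdjoinRoot.mkₐ _ (X * h) := by
    obtain ⟨q, rfl⟩ : ∃ q', q = q' + 1 := ⟨q - 1, by omega⟩
    change _ = AdjoinRoot.mk _ (X * h)
    simp only [h, map_mul, map_sub, map_pow, AdjoinRoot.mk_X, AdjoinRoot.mk_C,
      Nat.add_sub_cancel]
    ring
  have hP' : AdjoinRoot.mk (X ^ M₂ : (AdjoinRoot (X ^ M₁ : k[X]))[X])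
      (X ^ i * (h ^ i * aeval (X * h) Q)) = 0 := by
    rw [hf] at hP
    have := aeval_algHom_apply
      ((AdjoinRoot.mkₐ (X ^ M₂ : (AdjoinRoot (X ^ M₁ : k[X]))[X])).restrictScalars k)
      (X * h) (X ^ i * Q)
    have h2 := this.symm.trans hP
    rw [map_mul, map_pow, aeval_X, mul_pow, mul_assoc] at h2
    exact h2
  have hc := mk_X_pow_eq_zero_iff.mp hP' i (hiN.trans_le h₂)
  have hQ0 : (aeval (X * h) Q).coeff 0 = AdjoinRoot.of _ (Q.coeff 0) := by
    conv_lhs => rw [← divX_mul_X_add Q]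
    rw [map_add, map_mul, aeval_X, aeval_C, coeff_add]
    rw [← mul_assoc, mul_right_comm, mul_coeff_zero, mul_coeff_zero, coeff_X_zero]
    simp [Polynomial.algebraMap_apply, AdjoinRoot.algebraMap_eq]
  have hh0 : h.coeff 0 = a ^ e := by
    simp only [h, coeff_sub, coeff_C_zero, coeff_C_mul, coeff_X_pow]
    rw [if_neg (by omega), mul_zero, sub_zero]
  rw [coeff_X_pow_mul', if_pos le_rfl, Nat.sub_self, mul_coeff_zero, hQ0,
    ← constantCoeff_apply (h ^ i), map_pow, constantCoeff_apply, hh0, ha, ← AdjoinRoot.mk_X,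
    ← AdjoinRoot.mk_C, ← map_pow, ← map_pow, ← map_mul, mk_X_pow_eq_zero_iff] at hc
  have := hc (e * i) (h₁ i hiN)
  rw [← pow_mul, coeff_X_pow_mul', if_pos le_rfl, Nat.sub_self, coeff_C_zero] at this
  rw [coeff_X_pow_mul', if_pos le_rfl, Nat.sub_self] at hi0
  exact hi0 this

end Truncated

/-! ### Corepresentability -/

section Corepresentable

variable {K : Type u} [Field K]

/-- A set-valued functor whose points are given by finitely many coordinates `v i`, subject to the
conditions `v i ^ N i = 0`, is corepresentable. -/
theorem isCorepresentable_of_coordinates {F : CommAlgCat.{u} K ⥤ Type u} (m : ℕ) (N : Fin m → ℕ)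
    (e : ∀ R, F.obj R ≃ {v : Fin m → R // ∀ i, v i ^ N i = 0})
    (he : ∀ {R S : CommAlgCat.{u} K} (f : R ⟶ S) (x : F.obj R) (i : Fin m),
      (e S (F.map f x)).1 i = f ((e R x).1 i)) : F.IsCorepresentable := by
  let I : Ideal (MvPolynomial (Fin m) K) :=
    Ideal.span (Set.range fun i => (MvPolynomial.X i : MvPolynomial (Fin m) K) ^ N i)
  let A : CommAlgCat.{u} K := CommAlgCat.of K (MvPolynomial (Fin m) K ⧸ I)
  let ξ : Fin m → A := fun i => Ideal.Quotient.mk I (MvPolynomial.X i)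
  have hξ : ∀ i, ξ i ^ N i = 0 := fun i => by
    change (Ideal.Quotient.mk I (MvPolynomial.X i)) ^ N i = 0
    rw [← map_pow, Ideal.Quotient.eq_zero_iff_mem]
    exact Ideal.subset_span ⟨i, rfl⟩
  let coords : ∀ R : CommAlgCat.{u} K, (A ⟶ R) ≃ {v : Fin m → R // ∀ i, v i ^ N i = 0} := fun R =>
    { toFun := fun f => ⟨fun i => f (ξ i), fun i => by
        rw [← map_pow, hξ, map_zero]⟩
      invFun := fun v => CommAlgCat.ofHom (Ideal.Quotient.liftₐ I (MvPolynomial.aeval v.1) (by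
        have : I ≤ RingHom.ker (MvPolynomial.aeval (R := K) v.1) := by
          rw [Ideal.span_le]
          rintro _ ⟨i, rfl⟩
          change MvPolynomial.aeval v.1 _ = 0
          rw [map_pow, MvPolynomial.aeval_X, v.2]
        exact this))
      left_inv := fun f => by
        apply CommAlgCat.hom_ext
        apply Ideal.Quotient.algHom_ext
        apply MvPolynomial.algHom_ext
        intro i
        change MvPolynomial.aeval _ (MvPolynomial.X i) = f (ξ i)
        rw [MvPolynomial.aeval_X]
      right_inv := fun v => by
        ext i
        change MvPolynomial.aeval _ (MvPolynomial.X i) = _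
        rw [MvPolynomial.aeval_X] }
  refine ⟨A, ⟨⟨fun {R} => (coords R).trans (e R).symm, fun {R S} g f => ?_⟩⟩⟩
  apply (e S).injective
  ext i
  rw [he]
  simp only [Equiv.trans_apply, Equiv.apply_symm_apply]
  rfl

variable (p : ℕ) [Fact p.Prime] [CharP K p]

theorem isAffineGroupScheme_U (n : ℕ) : (U p K n).IsAffineGroupScheme := by
  -- The coordinate with index `i : Fin n` is `λ_{i+1}`, whence the exponent `n - (i + 1) + 1 = n -
  -- i`.
  refine isCorepresentable_of_coordinates n (fun i => p ^ (n - i)) (fun R =>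
    { toFun := fun x => ⟨fun i => (U.val (n := n) (R := R) x).coeff (i + 1), fun i => ?_⟩
      invFun := fun v => U.mk (R := R) (fun i => if h : 1 ≤ i ∧ i ≤ n then v.1 ⟨i - 1, by omega⟩ else 0)
        fun i h1 h2 => ?_
      left_inv := fun x => ?_
      right_inv := fun v => ?_ }) fun {R S} f x i => rfl
  · have := ((isUPoint_iff _).mp (U.isUPoint_val (n := n) (R := R) x)).2 (i + 1) (by omega)
    rwa [Nat.add_sub_add_right] at this
  · rw [dif_pos ⟨h1, h2⟩, show n + 1 - i = n - (i - 1) by omega]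
    exact v.2 ⟨i - 1, by omega⟩
  · refine U.ext_of_agreeUpTo (R := R) fun i hi => ?_
    rw [U.coeff_mk]
    split_ifs with h h'
    · rw [h]; exact (U.coeff_val_zero (R := R) _).symm
    · simp only [Nat.sub_add_cancel h'.1]
    · omega
  · ext i
    change (U.val (U.mk (R := R) _ _)).coeff _ = _
    rw [U.coeff_mk, if_neg (by omega), if_pos (by omega), dif_pos (by omega)]
    rfl

theorem isAffineGroupScheme_alpha (m : ℕ) : (alpha p K m).IsAffineGroupScheme :=
  isCorepresentable_of_coordinates 1 (fun _ => p ^ m) (fun R =>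
    { toFun := fun x => ⟨fun _ => (show alphaPoints p K m R from x).1,
        fun _ => (show alphaPoints p K m R from x).2⟩
      invFun := fun v => (⟨v.1 0, v.2 0⟩ : alphaPoints p K m R)
      left_inv := fun x => rfl
      right_inv := fun v => by
        ext i
        rw [Subsingleton.elim i 0] }) fun {R S} f x i => rfl

end Corepresentable

theorem ClosedSubgroup.ext_pts {K : Type u} [Field K] {G : GroupFunctor K} {H H' : ClosedSubgroup G}
    (h : ∀ R, H.pts R = H'.pts R) : H = H' := by
  obtain ⟨pts, _, _⟩ := H
  obtain ⟨pts', _, _⟩ := H'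
  obtain rfl : pts = pts' := funext h
  rfl

/-- Membership in a closed subgroup scheme can be tested after an injective ring extension. -/
theorem ClosedSubgroup.mem_of_map_mem {K : Type u} [Field K] {G : GroupFunctor K}
    (H : ClosedSubgroup G) {R S : CommAlgCat.{u} K} {f : R ⟶ S} (hf : Function.Injective f)
    {x : G.obj R} (hx : G.map f x ∈ H.pts S) : x ∈ H.pts R := by
  -- The ideal of `x` dies in `S`, hence is zero by injectivity, and so the identity of `R`
  -- satisfies the criterion.
  obtain ⟨I, hI⟩ := H.closed R x
  have := (hI R (𝟙 R)).mpr fun a ha => hf (((hI S f).mp hx a ha).trans (map_zero f.hom).symm)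
  simpa using this

/-! ### Products with `1 + b F ^ d` -/

section Monomials

variable {p : ℕ} [Fact p.Prime] {K : Type u} [Field K] [CharP K p]

theorem SkewPol.coeff_mul_monomial {R : Type v} [CommRing R] [Algebra K R] {P Q : SkewPol p K R}
    {d : ℕ} {b : R} (hd : d ≠ 0) (hQ : ∀ j, Q.coeff j = if j = 0 then 1 else if j = d then b else 0)
    (i : ℕ) : (P * Q).coeff (i + d) = P.coeff (i + d) + P.coeff i * b ^ p ^ i := by
  rw [SkewPol.coeff_mul, Finset.sum_eq_add_of_mem (i + d, 0) (i, d)]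
  · simp [hQ, hd]
  · simp
  · simp
  · simp [Prod.ext_iff, hd]
  · rintro ⟨j, l⟩ hjl ⟨h1, h2⟩
    have hjl' : j + l = i + d := Finset.HasAntidiagonal.mem_antidiagonal.mp hjl
    rw [hQ, if_neg, if_neg, zero_pow_pow, mul_zero]
    · rintro rfl
      exact h2 (by simpa using hjl')
    · rintro rfl
      exact h1 (by simpa using hjl')

theorem SkewPol.coeff_monomial_mul {R : Type v} [CommRing R] [Algebra K R] {P Q : SkewPol p K R}
    {d : ℕ} {b : R} (hd : d ≠ 0) (hQ : ∀ j, Q.coeff j = if j = 0 then 1 else if j = d then b else 0)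
    (i : ℕ) : (Q * P).coeff (i + d) = P.coeff (i + d) + b * P.coeff i ^ p ^ d := by
  rw [SkewPol.coeff_mul, Finset.sum_eq_add_of_mem (0, i + d) (d, i)]
  · simp [hQ, hd]
  · simp
  · simp [add_comm]
  · simp [Prod.ext_iff, hd.symm]
  · rintro ⟨j, l⟩ hjl ⟨h1, h2⟩
    have hjl' : j + l = i + d := Finset.HasAntidiagonal.mem_antidiagonal.mp hjl
    rw [hQ, if_neg, if_neg, zero_mul]
    · rintro rfl
      exact h2 (Prod.ext rfl (by omega))
    · rintro rfl
      exact h1 (by simpa using hjl')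

end Monomials

/-! ### The upper central series -/

section UpperCentral

open Polynomial

variable {p : ℕ} [Fact p.Prime] {K : Type u} [Field K] [CharP K p] {n : ℕ}

/-- A point of `U_n` is detected to be nontrivial in degree `i` by its commutator with the generic
point `1 + μ F`. -/
theorem coeff_eq_zero_of_commutators {R : CommAlgCat.{u} K} {x : (U p K n).obj R} {i k : ℕ}
    (hi : 1 ≤ i) (hik : i + 1 ≤ k) (hk : k ≤ n)
    (hx : ∀ (S : CommAlgCat.{u} K) (f : R ⟶ S), f.hom.toRingHom.Flat → Function.Injective f.hom →
      ∀ g : (U p K n).obj S, (U p K n).map f x * g * ((U p K n).map f x)⁻¹ * g⁻¹ ∈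
        (congruenceSubgroup p K n k).pts S) :
    (U.val x).coeff i = 0 := by
  have hp : 1 < p := (Fact.out : p.Prime).one_lt
  let q : R[X] := X ^ p ^ n
  let S : CommAlgCat.{u} K := CommAlgCat.of K (AdjoinRoot q)
  let f : R ⟶ S := CommAlgCat.ofHom (AdjoinRoot.ofAlgHom K q)
  let μ : S := AdjoinRoot.root q
  have hμ : μ ^ p ^ (n + 1 - 1) = 0 := root_X_pow_pow (R := R) (p ^ n)
  have h := hx S f (of_X_pow_flat (R := R) (p ^ n))
    (of_X_pow_injective (R := R) (pow_pos (by omega) n)) (U.single hμ)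
  rw [mem_congruenceSubgroup, U.agreeUpTo_commutator_iff] at h
  have h := h (i + 1) hik
  have hg := U.coeff_single hμ (show 1 ≤ n by omega)
  rw [SkewPol.coeff_mul_monomial one_ne_zero hg, SkewPol.coeff_monomial_mul one_ne_zero hg,
    add_right_inj, U.val_map] at h
  set a := (U.val x).coeff i
  have h' : AdjoinRoot.mk q (C a * X ^ p ^ i - X * C a ^ p ^ 1) = 0 := by
    rw [map_sub, sub_eq_zero]
    simp only [map_mul, map_pow, AdjoinRoot.mk_X, AdjoinRoot.mk_C]
    exact h
  -- Compare coefficients of `μ ^ p ^ i`. This power is not killed since `i < n`, and it differs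
  -- from `μ` since `i ≥ 1`, so only `a` contributes.
  have h'' := mk_X_pow_eq_zero_iff.mp h' (p ^ i) (Nat.pow_lt_pow_right hp (by omega))
  have h1 : 1 ≠ p ^ i := (Nat.one_lt_pow (by omega) hp).ne
  rw [← C_pow, coeff_sub, coeff_C_mul_X_pow, if_pos rfl, X_mul_C, coeff_C_mul_X, if_neg h1.symm,
    sub_zero] at h''
  exact h''

theorem upperCentral_eq {r : ℕ} (hr : r ≤ n) (R : CommAlgCat.{u} K) :
    upperCentral (U p K n) r R = (congruenceSubgroup p K n (n - r)).pts R := by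
  induction r generalizing R with
  | zero =>
    ext x
    rw [SetLike.mem_coe, mem_congruenceSubgroup]
    constructor
    · rintro rfl
      rw [map_one]
      exact AgreeUpTo.rfl
    · intro h
      exact U.ext_of_agreeUpTo (by simpa using h)
  | succ r ih =>
    have ih := ih (by omega)
    ext x
    constructor
    · intro h
      rw [SetLike.mem_coe, mem_congruenceSubgroup_iff_coeff]
      intro i hi hir
      refine coeff_eq_zero_of_commutators (k := n - r) hi (by omega) (by omega) fun S f h1 h2 g => ?_
      have := h S f h1 h2 g
      rwa [ih S] at this
    · intro h S f _ _ g
      rw [ih S, show n - r = n - (r + 1) + 1 by omega]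
      exact commutator_mem_congruenceSubgroup g ((congruenceSubgroup p K n _).map_mem f h)

end UpperCentral

/-! ### The lower central series -/

section LowerCentral

open Polynomial

variable {p : ℕ} [Fact p.Prime] {K : Type u} [Field K] [CharP K p] {n : ℕ}

/-- The commutator of `1 + b F` and `1 + a F ^ m` has leading coefficient
`b a ^ p - a b ^ p ^ m` in degree `m + 1`. -/
theorem commutator_single_agreeUpTo {R : CommAlgCat.{u} K} {m : ℕ} (hm : m ≠ 0) (hmn : m + 1 ≤ n)
    {a b c : R} (ha : a ^ p ^ (n + 1 - m) = 0) (hb : b ^ p ^ (n + 1 - 1) = 0)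
    (hc : c ^ p ^ (n + 1 - (m + 1)) = 0) (h : c = b * a ^ p - a * b ^ p ^ m) :
    AgreeUpTo (m + 1) (U.val (U.single hb * U.single ha * (U.single hb)⁻¹ * (U.single ha)⁻¹ :
      (U p K n).obj R)) (U.val (U.single hc)) := by
  set g : (U p K n).obj R := U.single hb
  set x : (U p K n).obj R := U.single ha
  set y : (U p K n).obj R := U.single hc
  have hg := U.coeff_single hb (show 1 ≤ n by omega)
  have hx := U.coeff_single ha (show m ≤ n by omega)
  have hy := U.coeff_single hc hmn
  -- Multiplying on the right by `(x g)⁻¹` turns this into the claim; only products with monomial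
  -- factors remain to be compared.
  suffices AgreeUpTo (m + 1) (U.val g * U.val x) (U.val y * (U.val x * U.val g)) by
    have h2 := this.mul (AgreeUpTo.rfl (P := U.val (x * g)⁻¹))
    simp only [← map_mul] at h2
    rw [← mul_assoc y x g, mul_assoc y x g, mul_inv_cancel_right, mul_inv_rev, ← mul_assoc] at h2
    exact h2
  have hy1 : AgreeUpTo m (U.val y) 1 := fun i hi => by
    rw [hy, SkewPol.coeff_one, if_neg (by omega : i ≠ m + 1)]
  have hx1 : AgreeUpTo (m - 1) (U.val x) 1 := fun i hi => by
    rw [hx, SkewPol.coeff_one, if_neg (by omega : i ≠ m)]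
  have hxg : AgreeUpTo m (U.val x * U.val g) (U.val g * U.val x) := by
    have := hx1.mul_comm (U.coeff_val_zero g)
    rwa [Nat.sub_add_cancel (by omega)] at this
  have hxg0 : (U.val x * U.val g).coeff 0 = 1 := by
    rw [SkewPol.coeff_mul_zero, U.coeff_val_zero, U.coeff_val_zero, mul_one]
  intro i hi
  rcases eq_or_ne i 0 with rfl | h0
  · simp only [SkewPol.coeff_mul_zero, U.coeff_val_zero, mul_one]
  rw [SkewPol.coeff_mul_of_agreeUpTo_one_left hy1 hxg0 h0 hi]
  rcases eq_or_ne i (m + 1) with rfl | h1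
  · rw [SkewPol.coeff_monomial_mul one_ne_zero hg, SkewPol.coeff_mul_monomial one_ne_zero hg, hy,
      if_neg h0, if_pos rfl, hx m, if_neg hm, if_pos rfl, h, pow_one]
    ring
  · rw [hy, if_neg h0, if_neg h1, zero_add, hxg i (by omega)]

/-- If a closed subgroup scheme contains all commutators of `U_n` with points `≡ 1` modulo `F ^ m`
and all points `≡ 1` modulo `F ^ (m + 2)`, then it contains the points `1 + c F ^ (m + 1)`. -/
theorem single_mem_of_commutators_mem (H : ClosedSubgroup (U p K n)) {m : ℕ} (hm : m ≠ 0)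
    (hmn : m + 1 ≤ n)
    (hH : ∀ (S : CommAlgCat.{u} K) (g x : (U p K n).obj S),
      x ∈ (congruenceSubgroup p K n (m - 1)).pts S → g * x * g⁻¹ * x⁻¹ ∈ H.pts S)
    (hH' : ∀ S, (congruenceSubgroup p K n (m + 1)).pts S ≤ H.pts S)
    {R : CommAlgCat.{u} K} {c : R} (hc : c ^ p ^ (n + 1 - (m + 1)) = 0) :
    (U.single hc : (U p K n).obj R) ∈ H.pts R := by
  have hp : 1 < p := (Fact.out : p.Prime).one_lt
  set N := p ^ (n + 1 - (m + 1)) with hN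
  let A : CommAlgCat.{u} K := CommAlgCat.of K (AdjoinRoot (X ^ N : K[X]))
  let ξ : A := AdjoinRoot.root (X ^ N : K[X])
  have hξ : ξ ^ N = 0 := root_X_pow_pow N
  -- Every `1 + c F ^ (m + 1)` is the image of the universal one over `A = K[ξ]/(ξ ^ N)`.
  suffices hu : (U.single hξ : (U p K n).obj A) ∈ H.pts A by
    let f : A ⟶ R := CommAlgCat.ofHom (AdjoinRoot.liftAlgHom _ (Algebra.ofId K R) c (by
      rw [eval₂_X_pow, hc]))
    have hfξ : f ξ = c := AdjoinRoot.liftAlgHom_root ..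
    have := H.map_mem f hu
    convert this
    refine U.ext_of_agreeUpTo fun i hi => ?_
    rw [U.val_map, U.coeff_single _ hmn, U.coeff_single _ hmn]
    split_ifs <;> simp [hfξ]
  let M₁ := p ^ (n + 1 - m)
  let M₂ := p ^ (n + 1 - 1)
  let B : CommAlgCat.{u} K :=
    CommAlgCat.of K (AdjoinRoot (X ^ M₂ : (AdjoinRoot (X ^ M₁ : K[X]))[X]))
  let a : B := AdjoinRoot.of (X ^ M₂ : (AdjoinRoot (X ^ M₁ : K[X]))[X]) (AdjoinRoot.root _)
  let b : B := AdjoinRoot.root (X ^ M₂ : (AdjoinRoot (X ^ M₁ : K[X]))[X])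
  have ha : a ^ p ^ (n + 1 - m) = 0 := by
    change (AdjoinRoot.of _ _) ^ M₁ = 0
    rw [← map_pow, root_X_pow_pow, map_zero]
  have hb : b ^ p ^ (n + 1 - 1) = 0 := root_X_pow_pow _
  have hM₁ : p * N = M₁ := by
    rw [hN, ← pow_succ', show n + 1 - (m + 1) + 1 = n + 1 - m by omega]
  -- As `N` is a power of `p`, raising to it is additive, and both terms vanish: `p N = M₁` kills
  -- the power of `a`, and `p ^ m N = M₂` that of `b`.
  have hc' : (b * a ^ p - a * b ^ p ^ m) ^ N = 0 := by
    rw [sub_eq_add_neg, hN, add_pow_pow p K, neg_pow, mul_pow, mul_pow, ← hN, ← pow_mul a, hM₁, ha,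
      hN, ← pow_mul b, ← pow_add, show m + (n + 1 - (m + 1)) = n + 1 - 1 by omega, hb]
    simp
  let φ : A ⟶ B := CommAlgCat.ofHom (AdjoinRoot.liftAlgHom _ (Algebra.ofId K B)
    (b * a ^ p - a * b ^ p ^ m) (by rw [eval₂_X_pow, hc']))
  have hφξ : φ ξ = b * a ^ p - a * b ^ p ^ m := AdjoinRoot.liftAlgHom_root ..
  have hφ : Function.Injective φ := by
    refine (injective_iff_map_eq_zero φ.hom).mpr fun z hz => ?_
    obtain ⟨P, rfl⟩ := AdjoinRoot.mk_surjective z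
    rw [AdjoinRoot.mk_eq_zero]
    refine X_pow_dvd_of_aeval_eq_zero (M₁ := M₁) (M₂ := M₂) (e := p) (q := p ^ m) ?_ ?_ ?_ hz
    · exact Nat.one_lt_pow hm hp
    · intro i hi
      rw [← hM₁]
      exact Nat.mul_lt_mul_of_pos_left hi (by omega)
    · exact Nat.pow_le_pow_right (by omega) (by omega)
  -- Membership descends along the injection `φ`. Over `B`, the image of the universal point differs
  -- from an actual commutator by a point congruent to 1 up to degree `m + 1`, which lies in `H` by
  -- `hH'`.
  refine H.mem_of_map_mem hφ ?_
  have hcomm := hH B (U.single hb) (U.single ha) fun i hi => by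
    rw [U.coeff_single _ (by omega), SkewPol.coeff_one, if_neg (by omega : i ≠ m)]
  have hag := commutator_single_agreeUpTo hm hmn ha hb hc' rfl
  have hφu : (U p K n).map φ (U.single hξ) = U.single hc' := by
    refine U.ext_of_agreeUpTo fun i hi => ?_
    rw [U.val_map, U.coeff_single _ hmn, U.coeff_single _ hmn]
    split_ifs <;> simp [hφξ]
  rw [hφu]
  have := (H.pts B).mul_mem (hH' B (U.agreeUpTo_iff_div.mpr hag.symm)) hcomm
  rwa [inv_mul_cancel_right] at this

/-- A closed subgroup scheme that contains the commutators of `U_n` with a congruence subgroup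
contains the next congruence subgroups. -/
theorem congruenceSubgroup_le_of_commutators_mem (H : ClosedSubgroup (U p K n)) {k : ℕ}
    (hH : ∀ (S : CommAlgCat.{u} K) (g x : (U p K n).obj S),
      x ∈ (congruenceSubgroup p K n k).pts S → g * x * g⁻¹ * x⁻¹ ∈ H.pts S)
    {j : ℕ} (hj : j ≤ n) (hkj : k + 1 ≤ j) (R : CommAlgCat.{u} K) :
    (congruenceSubgroup p K n j).pts R ≤ H.pts R := by
  -- Descend from `j = n`, where the congruence subgroup is trivial. In the step, a point is split
  -- into its leading monomial factor and a factor one level deeper.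
  induction hj using Nat.decreasingInduction generalizing R with
  | self =>
    intro x hx
    rw [show x = 1 from U.ext_of_agreeUpTo (by simpa using mem_congruenceSubgroup.mp hx)]
    exact one_mem _
  | of_succ j hj ih =>
    have ih := fun S => ih (by omega) S
    intro x hx
    rw [mem_congruenceSubgroup] at hx
    have hc := ((isUPoint_iff _).mp (U.isUPoint_val x)).2 (j + 1) (by omega)
    have hy := single_mem_of_commutators_mem H (m := j) (by omega) hj
      (fun S g x hx => hH S g x (AgreeUpTo.mono hx (by omega))) ih hc
    have : AgreeUpTo (j + 1) (U.val x) (U.val (U.single hc)) := fun i hi => by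
      rw [U.coeff_single _ hj]
      split_ifs with h0 h1
      · rw [h0, U.coeff_val_zero]
      · rw [h1]
      · rw [hx i (by omega), SkewPol.coeff_one, if_neg h0]
    simpa using (H.pts R).mul_mem (ih R (U.agreeUpTo_iff_div.mpr this)) hy

/-- The next congruence subgroup is itself one of the subgroups being intersected, and it is
contained in all the others. -/
theorem commutatorClosure_congruenceSubgroup {k : ℕ} (hk : k + 1 ≤ n) :
    commutatorClosure (congruenceSubgroup p K n k) = congruenceSubgroup p K n (k + 1) := by
  refine ClosedSubgroup.ext_pts fun R => le_antisymm ?_ ?_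
  · exact iInf₂_le (congruenceSubgroup p K n (k + 1)) fun S g x hx =>
      commutator_mem_congruenceSubgroup' g hx
  · exact le_iInf₂ fun H hH => congruenceSubgroup_le_of_commutators_mem H hH hk le_rfl R

theorem congruenceSubgroup_zero_pts (R : CommAlgCat.{u} K) :
    (congruenceSubgroup p K n 0).pts R = ⊤ := by
  rw [eq_top_iff]
  intro x _
  rw [mem_congruenceSubgroup_iff_coeff]
  intro i h1 h2
  omega

theorem lowerCentral_eq {s : ℕ} (hs : s ≤ n) :
    lowerCentral (U p K n) s = congruenceSubgroup p K n s := by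
  induction s with
  | zero => exact ClosedSubgroup.ext_pts fun R => (congruenceSubgroup_zero_pts R).symm
  | succ s ih => rw [lowerCentral, ih (by omega), commutatorClosure_congruenceSubgroup hs]

end LowerCentral

/-! ### The quotients -/

section Quotients

variable {p : ℕ} [Fact p.Prime] {K : Type u} [Field K] [CharP K p] {n : ℕ}

/-- The leading coefficient `1 + ∑_{i > k} λ_i F ^ i ↦ λ_{k + 1}`. -/
def leadingCoeff (p : ℕ) [Fact p.Prime] (K : Type u) [Field K] [CharP K p] (n k : ℕ) :
    (congruenceSubgroup p K n k).toFunctor ⟶ alpha p K (n + 1 - (k + 1)) where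
  app R := GrpCat.ofHom
    { toFun := fun x => Multiplicative.ofAdd (⟨(U.val x.1).coeff (k + 1),
        ((isUPoint_iff _).mp (U.isUPoint_val x.1)).2 (k + 1) (by omega)⟩ :
          alphaPoints p K (n + 1 - (k + 1)) R)
      map_one' := by
        refine Subtype.ext ?_
        change (U.val (1 : (U p K n).obj R)).coeff (k + 1) = 0
        rw [map_one, SkewPol.coeff_one, if_neg (by omega)]
      map_mul' := fun x y => by
        refine Subtype.ext ?_
        change (U.val (x.1 * y.1)).coeff (k + 1) =
          (U.val x.1).coeff (k + 1) + (U.val y.1).coeff (k + 1)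
        rw [map_mul, SkewPol.coeff_mul_of_agreeUpTo_one_left x.2 (U.coeff_val_zero y.1) (by omega)
          le_rfl] }
  naturality _ _ _ := rfl

/-- The leading coefficient has the functorial set-theoretic section `a ↦ 1 + a F ^ (k + 1)`, so
points lift over `R` itself and the identity serves as the fppf cover. -/
theorem isQuotient_congruenceSubgroup {k : ℕ} (hk : k + 1 ≤ n) :
    IsQuotient (congruenceSubgroup p K n k) (congruenceSubgroup p K n (k + 1))
      (alpha p K (n + 1 - (k + 1))) := by
  refine ⟨isAffineGroupScheme_alpha p _, fun R x hx => AgreeUpTo.mono hx (by omega),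
    leadingCoeff p K n k, fun R x => ?_, fun R q => ?_⟩
  · have h1 : (leadingCoeff p K n k).app R x = 1 ↔ (U.val x.1).coeff (k + 1) = 0 :=
      ⟨fun h => congrArg (fun a : Multiplicative (alphaPoints p K (n + 1 - (k + 1)) R) =>
        (a.toAdd : R)) h, fun h => Subtype.ext h⟩
    rw [h1, mem_congruenceSubgroup]
    constructor
    · intro h i hi
      rcases Nat.lt_or_eq_of_le hi with hi | rfl
      · exact x.2 i (by omega)
      · rw [h, SkewPol.coeff_one, if_neg (by omega)]
    · intro h
      rw [h (k + 1) le_rfl, SkewPol.coeff_one, if_neg (by omega)]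
  · let q' : alphaPoints p K (n + 1 - (k + 1)) R := q
    have hq : (q' : R) ^ p ^ (n + 1 - (k + 1)) = 0 := q'.2
    refine ⟨R, 𝟙 R, RingHom.FaithfullyFlat.of_bijective Function.bijective_id,
      RingHom.FinitePresentation.id R, ⟨U.single hq, fun i hi => ?_⟩, ?_⟩
    · rw [U.coeff_single _ hk, SkewPol.coeff_one, if_neg (by omega : i ≠ k + 1)]
    · refine Subtype.ext ?_
      change (U.val (U.single hq : (U p K n).obj R)).coeff (k + 1) = q'
      rw [U.coeff_single _ hk, if_neg (by omega), if_pos rfl]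

end Quotients

end

end FrobeniusSkew

theorem proposition4p3 (p : ℕ) [Fact p.Prime] (K : Type u) [Field K] [CharP K p] (n : ℕ) :
    (FrobeniusSkew.U p K n).IsAffineGroupScheme ∧
    ∃ G : ℕ → FrobeniusSkew.ClosedSubgroup (FrobeniusSkew.U p K n),
      -- the points of `G_r` are the `1 + ∑_{i > n - r} λ_i F ^ i` in `U_n`
      (∀ r ≤ n, ∀ (R : CommAlgCat.{u} K) (x : (FrobeniusSkew.U p K n).obj R),
        x ∈ (G r).pts R ↔ ∀ i, 1 ≤ i → i ≤ n - r → FrobeniusSkew.U.coeff p K x i = 0) ∧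
      -- they form an ascending chain from `{1}` to `U_n`
      (∀ R : CommAlgCat.{u} K, (G 0).pts R = ⊥) ∧
      (∀ R : CommAlgCat.{u} K, (G n).pts R = ⊤) ∧
      (∀ r < n, ∀ R : CommAlgCat.{u} K, (G r).pts R ≤ (G (r + 1)).pts R) ∧
      -- upper central series
      (∀ r ≤ n, ∀ R : CommAlgCat.{u} K,
        ((G r).pts R : Set ((FrobeniusSkew.U p K n).obj R)) =
          FrobeniusSkew.upperCentral (FrobeniusSkew.U p K n) r R) ∧
      -- lower central series
      (∀ r ≤ n, FrobeniusSkew.lowerCentral (FrobeniusSkew.U p K n) (n - r) = G r) ∧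
      -- quotients
      (∀ r < n, FrobeniusSkew.IsQuotient (G (r + 1)) (G r) (FrobeniusSkew.alpha p K (r + 1))) := by
  refine ⟨FrobeniusSkew.isAffineGroupScheme_U p n,
    fun r => FrobeniusSkew.congruenceSubgroup p K n (n - r),
    fun r _ R x => FrobeniusSkew.mem_congruenceSubgroup_iff_coeff, fun R => ?_, fun R => ?_,
    fun r _ R x hx => FrobeniusSkew.AgreeUpTo.mono hx (by omega),
    fun r hr R => (FrobeniusSkew.upperCentral_eq hr R).symm,
    fun r _ => FrobeniusSkew.lowerCentral_eq (by omega), fun r hr => ?_⟩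
  -- Triviality of `G_0` is the case `r = 0` of the upper central series, where `Z_0 = {1}` by
  -- definition.
  · exact SetLike.coe_injective (FrobeniusSkew.upperCentral_eq (Nat.zero_le n) R).symm
  · simpa using FrobeniusSkew.congruenceSubgroup_zero_pts R
  · have := FrobeniusSkew.isQuotient_congruenceSubgroup (p := p) (K := K) (n := n)
      (k := n - (r + 1)) (by omega)
    rwa [show n - (r + 1) + 1 = n - r by omega, show n + 1 - (n - r) = r + 1 by omega] at this
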